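/- All graphs are finite and simple. For a graph $G$ and $k\in\mathbb{N}$, a total-$k$-coloring of $G$ is a map $\varphi: V(G)\cup E(G)\to\{1,\dots,k\}$ such that adjacent vertices receive different colors, distinct edges with a common endpoint receive different colors, and no edge receives the same color as one of its endpoints. If $H$ is a subgraph of $G$, a total-$k$-coloring $\varphi$ of $H$ is called a total-$k$-coloring of $H$ in $G$ if moreover $\varphi(u)\neq\varphi(v)$ for all $u,v\in V(H)$ that are adjacent in $G$ (even if they are not adjacent in $H$). Such a $\varphi$ extends to $G$ if there is a total-$k$-coloring of $G$ that agrees with $\varphi$ on all vertices and edges of $H$. Theorem. Let $G$ be a planar bipartite graph with maximum degree $\Delta$, let $d\ge 0$ be an integer, and let $H$ be a subgraph of $G$ of maximum degree at most $d$. Then every total-$(\Delta+d+4)$-coloring of $H$ in $G$ extends to $G$. -/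

import Mathlib

namespace TotalColoringExtension

/-- The Euclidean plane. -/
abbrev Plane : Type := EuclideanSpace ℝ (Fin 2)

/-- A drawing of `G` in the plane without crossings: the vertices are distinct points, every edge
is a simple arc joining its two ends, no arc contains a vertex other than at its two end points,
and two distinct arcs meet only in common end points. -/
structure PlaneDrawing {V : Type*} (G : SimpleGraph V) where
  /-- the point that represents a vertex -/
  point : V → Plane
  /-- the arc that represents an edge -/
  arc : G.edgeSet → C(unitInterval, Plane)
  point_injective : Function.Injective point
  arc_injective : ∀ e, Function.Injective (arc e)
  arc_ends : ∀ e : G.edgeSet, s(arc e 0, arc e 1) = e.1.map point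
  eq_end_of_arc_eq_point : ∀ (e : G.edgeSet) (t : unitInterval) (v : V),
    arc e t = point v → t = 0 ∨ t = 1
  eq_end_of_arc_eq_arc : ∀ e f : G.edgeSet, e ≠ f → ∀ s t : unitInterval,
    arc e s = arc f t → (s = 0 ∨ s = 1) ∧ (t = 0 ∨ t = 1)

/-- A graph is planar if it can be drawn in the plane without crossings. -/
def IsPlanar {V : Type*} (G : SimpleGraph V) : Prop :=
  Nonempty (PlaneDrawing G)

/-- A total-`k`-coloring of `G`: a proper vertex coloring and a proper edge coloring (that is, a
proper coloring of the line graph) with the same `k` colors, such that no edge has the color of one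
of its ends. -/
structure TotalColoring {V : Type*} (G : SimpleGraph V) (k : ℕ) where
  /-- the coloring of the vertices -/
  vert : G.Coloring (Fin k)
  /-- the coloring of the edges -/
  edge : G.lineGraph.Coloring (Fin k)
  edge_ne_vert : ∀ (e : G.edgeSet) (v : V), v ∈ e.1 → edge e ≠ vert v

/-- The total coloring `φ` of the subgraph `H` is a total coloring of `H` *in* `G`: vertices of `H`
that are adjacent in `G` (and possibly not in `H`) have different colors. -/
def TotalColoring.IsIn {V : Type*} {G : SimpleGraph V} {H : G.Subgraph} {k : ℕ}
    (φ : TotalColoring H.coe k) : Prop :=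
  ∀ u v : H.verts, G.Adj u v → φ.vert u ≠ φ.vert v

/-- The total coloring `ψ` of `G` agrees with the total coloring `φ` of the subgraph `H` on all the
vertices and edges of `H`. -/
def TotalColoring.Extends {V : Type*} {G : SimpleGraph V} {H : G.Subgraph} {k : ℕ}
    (ψ : TotalColoring G k) (φ : TotalColoring H.coe k) : Prop :=
  (∀ v : H.verts, ψ.vert v = φ.vert v) ∧
    ∀ e : H.coe.edgeSet, ψ.edge (H.hom.mapEdgeSet e) = φ.edge e

end TotalColoringExtension

/-!
The vertices are colored first, greedily, as there are more than `Δ` colors. An edge `uv` outside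
`H` then has to avoid the colors of `u`, `v` and of the edges of `H` at `u` and `v`, so at least
`Δ + d - d_H(u) - d_H(v)` of the `Δ + d + 2` colors are left. As the degrees in `H` are at most `d`,
this is at least the degree of `u` and that of `v` in `G - E(H)`, and the edges outside `H` can be
colored by the theorem of Borodin, Kostochka and Woodall: a bipartite multigraph is edge-colorable
from lists whose sizes are at least the larger end degree of each edge.

Galvin's method reduces that theorem to a proper edge labeling such that, when one side of the
bipartition prefers small and the other side large labels, fewer competitors of `uv` are preferred
to it than `max (deg u) (deg v)`. Such a labeling arises by deleting matchings repeatedly and giving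
their edges extreme labels. The matchings are chosen such that, with a vertex of one fixed side,
they cover all its neighbors whose degree is not smaller; so every edge at such a vertex loses one
from its larger end degree, which makes up for the competitor that the matching adds. They are found
by a minimal violation of Hall's condition, on the side with more vertices of maximum degree.
-/

namespace TotalColoringExtension

open Finset

section BipartiteMultigraph

variable {E A B C ι α β : Type*} {a : E → A} {b : E → B} {p : E → α} {q : E → β}
  {F M P : Finset E} {e f m : E}

/-- The labels of the edges in `F` are distinct around every `a`-end. Here and below, a bipartite
multigraph is a finite set `F` of edges with maps `a : E → A` and `b : E → B` to their ends; a
matching is a set of edges on which both maps are injective. -/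
def IsProperAt (a : E → A) (F : Finset E) (c : E → C) : Prop :=
  ∀ ⦃e⦄, e ∈ F → ∀ ⦃f⦄, f ∈ F → a e = a f → c e = c f → e = f

/-- The degree, in the multigraph `F`, of the `a`-end of the edge `e`. -/
def degreeAt [DecidableEq A] (a : E → A) (F : Finset E) (e : E) : ℕ :=
  #{f ∈ F | a f = a e}

/-- The number of edges that the `a`-end of `e` prefers to `e`, where edges of small label `p` are
preferred. -/
def rankAt [DecidableEq A] [LinearOrder α] (a : E → A) (p : E → α) (F : Finset E) (e : E) : ℕ :=
  #{f ∈ F | a f = a e ∧ p f < p e}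

theorem IsProperAt.mono {c : E → C} (h : IsProperAt a F c) (hM : M ⊆ F) : IsProperAt a M c :=
  fun _ he _ hf => h (hM he) (hM hf)

theorem IsProperAt.neg {c : E → ℤ} (h : IsProperAt a F c) : IsProperAt a F (-c) :=
  fun _ he _ hf hef hc => h he hf hef (neg_injective hc)

theorem IsProperAt.piecewise [DecidableEq E] {g c : E → C} (hg : IsProperAt a P g)
    (hc : IsProperAt a (F \ P) c) (hgc : ∀ e ∈ P, ∀ f ∈ F \ P, a e = a f → g e ≠ c f) :
    IsProperAt a F (P.piecewise g c) := by
  intro e he f hf hef hcol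
  by_cases heP : e ∈ P <;> by_cases hfP : f ∈ P <;>
    simp only [piecewise_eq_of_mem, piecewise_eq_of_notMem, heP, hfP, not_false_eq_true] at hcol
  · exact hg heP hfP hef hcol
  · exact (hgc e heP f (mem_sdiff.2 ⟨hf, hfP⟩) hef hcol).elim
  · exact (hgc f hfP e (mem_sdiff.2 ⟨he, heP⟩) hef.symm hcol.symm).elim
  · exact hc (mem_sdiff.2 ⟨he, heP⟩) (mem_sdiff.2 ⟨hf, hfP⟩) hef hcol

theorem IsProperAt.piecewise_const [DecidableEq E] {c : E → C} {z : C} (hM : Set.InjOn a M)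
    (hc : IsProperAt a (F \ M) c) (hz : ∀ e ∈ F \ M, c e ≠ z) :
    IsProperAt a F (M.piecewise (fun _ => z) c) :=
  IsProperAt.piecewise (fun _ he _ hf hef _ => hM he hf hef) hc fun _ _ f hf _ => (hz f hf).symm

theorem card_filter_lt_card_filter {s t : Finset ι} {r : ι → Prop} [DecidablePred r] {i : ι}
    (hst : s ⊆ t) (hit : i ∈ t) (his : i ∉ s) (hi : r i) :
    #{j ∈ s | r j} < #{j ∈ t | r j} :=
  card_lt_card <| (ssubset_iff_of_subset (filter_subset_filter _ hst)).2
    ⟨i, mem_filter.2 ⟨hit, hi⟩, fun h => his (mem_filter.1 h).1⟩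

section Degree

variable [DecidableEq A]

theorem degreeAt_congr (h : a e = a f) : degreeAt a F e = degreeAt a F f := by
  simp only [degreeAt, h]

theorem degreeAt_mono (h : M ⊆ F) : degreeAt a M e ≤ degreeAt a F e :=
  card_le_card (filter_subset_filter _ h)

theorem degreeAt_sdiff_lt [DecidableEq E] (hMF : M ⊆ F) (h : a e ∈ a '' M) :
    degreeAt a (F \ M) e < degreeAt a F e := by
  obtain ⟨m, hm, hme⟩ := h
  exact card_filter_lt_card_filter sdiff_subset (hMF hm) (fun h => (mem_sdiff.1 h).2 hm) hme

theorem degreeAt_sdiff_add [DecidableEq E] (h : P ⊆ F) :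
    degreeAt a (F \ P) e + degreeAt a P e = degreeAt a F e := by
  rw [degreeAt, degreeAt, degreeAt, ← card_union_of_disjoint
    (disjoint_filter_filter sdiff_disjoint), ← filter_union, sdiff_union_of_subset h]

variable [LinearOrder α]

theorem rankAt_mono (h : M ⊆ F) : rankAt a p M e ≤ rankAt a p F e :=
  card_le_card (filter_subset_filter _ h)

theorem rankAt_sdiff_lt [DecidableEq E] (hm : m ∈ M) (hmF : m ∈ F) (hme : a m = a e)
    (hlt : p m < p e) : rankAt a p (F \ M) e < rankAt a p F e :=
  card_filter_lt_card_filter sdiff_subset hmF (fun h => (mem_sdiff.1 h).2 hm) ⟨hme, hlt⟩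

theorem rankAt_lt_degreeAt (he : e ∈ F) : rankAt a p F e < degreeAt a F e :=
  card_lt_card <| (ssubset_iff_of_subset (monotone_filter_right _ fun _ _ hf => hf.1)).2
    ⟨e, by simp only [mem_filter, he, and_self], by simp only [mem_filter, lt_irrefl, and_false,
      not_false_eq_true]⟩

end Degree

section StableMatching

variable [LinearOrder α] [LinearOrder β]

/-- A matching `M` in the bipartite multigraph `F` is stable when every other edge loses against
an edge of `M` at one of its ends: the `a`-ends prefer edges of small label `p`, the `b`-ends edges
of small label `q`. -/
structure IsStableMatching (a : E → A) (b : E → B) (p : E → α) (q : E → β) (F M : Finset E) :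
    Prop where
  subset : M ⊆ F
  injOn_left : Set.InjOn a M
  injOn_right : Set.InjOn b M
  exists_lt : ∀ e ∈ F, e ∉ M → ∃ m ∈ M, a m = a e ∧ p m < p e ∨ b m = b e ∧ q m < q e

open scoped Classical in
/-- The edges that are the first choice of their `a`-end, in the sense of Gale and Shapley's
algorithm. -/
noncomputable def favorites (a : E → A) (p : E → α) (F : Finset E) : Finset E :=
  {e ∈ F | ∀ f ∈ F, a f = a e → p e ≤ p f}

theorem mem_favorites : e ∈ favorites a p F ↔ e ∈ F ∧ ∀ f ∈ F, a f = a e → p e ≤ p f := by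
  simp only [favorites, mem_filter]

theorem favorites_subset : favorites a p F ⊆ F :=
  fun _ he => (mem_favorites.1 he).1

theorem isStableMatching_favorites (hp : IsProperAt a F p)
    (hb : Set.InjOn b (favorites a p F)) : IsStableMatching a b p q F (favorites a p F) where
  subset := favorites_subset
  injOn_left e he f hf hef := by
    obtain ⟨heF, he⟩ := mem_favorites.1 he
    obtain ⟨hfF, hf⟩ := mem_favorites.1 hf
    exact hp heF hfF hef (le_antisymm (he f hfF hef.symm) (hf e heF hef))
  injOn_right := hb
  exists_lt e he hefav := by
    classical
    obtain ⟨m, hm, hmin⟩ := exists_min_image {f ∈ F | a f = a e} p ⟨e, mem_filter.2 ⟨he, rfl⟩⟩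
    simp only [mem_filter, and_imp] at hm hmin
    refine ⟨m, mem_favorites.2 ⟨hm.1, fun f hf hfm => hmin f hf (hfm.trans hm.2)⟩, .inl ⟨hm.2, ?_⟩⟩
    by_contra! hle
    exact hefav (mem_favorites.2 ⟨he, fun f hf hfe => hle.trans (hmin f hf hfe)⟩)

theorem IsStableMatching.of_erase [DecidableEq E] (he : e ∈ favorites a p F) (hef : b e = b f)
    (hlt : q e < q f) (hM : IsStableMatching a b p q (F.erase f) M) :
    IsStableMatching a b p q F M where
  subset := hM.subset.trans (erase_subset _ _)
  injOn_left := hM.injOn_left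
  injOn_right := hM.injOn_right
  exists_lt x hx hxM := by
    obtain rfl | hxf := eq_or_ne x f
    · by_cases heM : e ∈ M
      · exact ⟨e, heM, .inr ⟨hef, hlt⟩⟩
      obtain ⟨heF, hfav⟩ := mem_favorites.1 he
      have hne : e ≠ x := by rintro rfl; exact hlt.false
      obtain ⟨m, hm, ⟨hme, hlt'⟩ | ⟨hme, hlt'⟩⟩ := hM.exists_lt e (mem_erase.2 ⟨hne, heF⟩) heM
      · exact absurd hlt' (hfav m (mem_of_mem_erase (hM.subset hm)) hme).not_gt
      · exact ⟨m, hm, .inr ⟨hme.trans hef, hlt'.trans hlt⟩⟩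
    · exact hM.exists_lt x (mem_erase.2 ⟨hxf, hx⟩) hxM

theorem exists_isStableMatching (hp : IsProperAt a F p) (hq : IsProperAt b F q) :
    ∃ M, IsStableMatching a b p q F M := by
  classical
  induction F using Finset.strongInduction with
  | H F ih =>
  by_cases hb : Set.InjOn b (favorites a p F)
  · exact ⟨_, isStableMatching_favorites hp hb⟩
  obtain ⟨e, he, f, hf, hef, hlt⟩ :
      ∃ e ∈ favorites a p F, ∃ f ∈ favorites a p F, b e = b f ∧ q e < q f := by
    simp only [Set.InjOn, not_forall] at hb
    obtain ⟨e, he, f, hf, hef, hne⟩ := hb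
    have hqne : q e ≠ q f := fun h => hne (hq (favorites_subset he) (favorites_subset hf) hef h)
    obtain hlt | hlt := hqne.lt_or_gt
    exacts [⟨e, he, f, hf, hef, hlt⟩, ⟨f, hf, e, he, hef.symm, hlt⟩]
  obtain ⟨M, hM⟩ := ih (F.erase f) (erase_ssubset (favorites_subset hf))
    (hp.mono (erase_subset _ _)) (hq.mono (erase_subset _ _))
  exact ⟨M, hM.of_erase he hef hlt⟩

variable [DecidableEq A] [DecidableEq B]

theorem IsStableMatching.rankAt_sdiff_add_lt [DecidableEq E] (hM : IsStableMatching a b p q P M)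
    (hPF : P ⊆ F) (he : e ∈ P) (heM : e ∉ M) :
    rankAt a p (F \ M) e + rankAt b q (F \ M) e < rankAt a p F e + rankAt b q F e := by
  have hMF : M ⊆ F := hM.subset.trans hPF
  obtain ⟨m, hm, ⟨hme, hlt⟩ | ⟨hme, hlt⟩⟩ := hM.exists_lt e he heM
  · exact add_lt_add_of_lt_of_le (rankAt_sdiff_lt hm (hMF hm) hme hlt) (rankAt_mono sdiff_subset)
  · exact add_lt_add_of_le_of_lt (rankAt_mono sdiff_subset) (rankAt_sdiff_lt hm (hMF hm) hme hlt)

/-- Galvin's argument: the color `z` goes to a stable matching among the edges that admit it, and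
every other such edge loses one competitor together with the color. -/
theorem exists_listColoring_of_rankAt_lt [Nonempty C] (L : E → Finset C) (hp : IsProperAt a F p)
    (hq : IsProperAt b F q) (hL : ∀ e ∈ F, rankAt a p F e + rankAt b q F e < #(L e)) :
    ∃ c : E → C, (∀ e ∈ F, c e ∈ L e) ∧ IsProperAt a F c ∧ IsProperAt b F c := by
  classical
  induction F using Finset.strongInduction generalizing L with
  | H F ih =>
  obtain rfl | ⟨e₀, he₀⟩ := F.eq_empty_or_nonempty
  · exact ⟨fun _ => Classical.arbitrary C, by simp, by simp [IsProperAt], by simp [IsProperAt]⟩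
  obtain ⟨z, hz⟩ : (L e₀).Nonempty := card_pos.1 (Nat.zero_lt_of_lt (hL e₀ he₀))
  have hPF : {e ∈ F | z ∈ L e} ⊆ F := filter_subset _ _
  obtain ⟨M, hM⟩ := exists_isStableMatching (hp.mono hPF) (hq.mono hPF)
  have hMne : M.Nonempty := by
    by_cases he₀M : e₀ ∈ M
    · exact ⟨e₀, he₀M⟩
    · obtain ⟨m, hm, -⟩ := hM.exists_lt e₀ (mem_filter.2 ⟨he₀, hz⟩) he₀M
      exact ⟨m, hm⟩
  have hlists : ∀ e ∈ F \ M, rankAt a p (F \ M) e + rankAt b q (F \ M) e < #((L e).erase z) := by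
    intro e he
    obtain ⟨heF, heM⟩ := mem_sdiff.1 he
    have hLe := hL e heF
    by_cases hze : z ∈ L e
    · have hdrop := hM.rankAt_sdiff_add_lt hPF (mem_filter.2 ⟨heF, hze⟩) heM
      rw [card_erase_of_mem hze]
      omega
    · rw [erase_eq_of_notMem hze]
      exact (add_le_add (rankAt_mono sdiff_subset) (rankAt_mono sdiff_subset)).trans_lt hLe
  obtain ⟨c, hcL, hca, hcb⟩ := ih (F \ M) (sdiff_ssubset (hM.subset.trans hPF) hMne)
    (fun e => (L e).erase z) (hp.mono sdiff_subset) (hq.mono sdiff_subset) hlists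
  have hcz : ∀ e ∈ F \ M, c e ≠ z := fun e he => ne_of_mem_erase (hcL e he)
  refine ⟨M.piecewise (fun _ => z) c, fun e he => ?_, hca.piecewise_const hM.injOn_left hcz,
    hcb.piecewise_const hM.injOn_right hcz⟩
  by_cases heM : e ∈ M
  · rw [piecewise_eq_of_mem _ _ _ heM]
    exact (mem_filter.1 (hM.subset heM)).2
  · rw [piecewise_eq_of_notMem _ _ _ heM]
    exact mem_of_mem_erase (hcL e (mem_sdiff.2 ⟨he, heM⟩))

end StableMatching

section Hall

variable [DecidableEq A] {t : ι → Finset A} {D : Finset ι}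

theorem exists_injOn_of_card_le_card_biUnion [Nonempty A]
    (h : ∀ U ⊆ D, #U ≤ #(U.biUnion t)) :
    ∃ g : ι → A, Set.InjOn g D ∧ ∀ i ∈ D, g i ∈ t i := by
  classical
  obtain ⟨g, hg, hgt⟩ := (all_card_le_biUnion_card_iff_exists_injective (fun i : D => t i)).1
    fun U => by
      have hU := h (U.map (.subtype _)) (map_subtype_subset U)
      rwa [card_map, map_eq_image, image_biUnion] at hU
  refine ⟨fun i => if hi : i ∈ D then g ⟨i, hi⟩ else Classical.arbitrary A, ?_, ?_⟩
  · intro i hi j hj hij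
    simp only [dif_pos (mem_coe.1 hi), dif_pos (mem_coe.1 hj)] at hij
    exact Subtype.ext_iff.1 (hg hij)
  · intro i hi
    simpa only [dif_pos hi] using hgt ⟨i, hi⟩

/-- In a minimal nonempty `D` with at most `#D` neighbors, Hall's condition holds, as one sees by
deleting a single element; so `D` is matched with all of its neighbors. -/
theorem exists_injOn_biUnion_subset_image (hne : D.Nonempty) (ht : ∀ i ∈ D, (t i).Nonempty)
    (hD : #(D.biUnion t) ≤ #D) :
    ∃ D' ⊆ D, D'.Nonempty ∧ ∃ g : ι → A,
      Set.InjOn g D' ∧ (∀ i ∈ D', g i ∈ t i) ∧ D'.biUnion t ⊆ D'.image g := by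
  classical
  induction D using Finset.strongInduction with
  | H D ih =>
  by_cases hmin : ∃ U ⊂ D, U.Nonempty ∧ #(U.biUnion t) ≤ #U
  · obtain ⟨U, hUD, hUne, hU⟩ := hmin
    obtain ⟨D', hD', h⟩ := ih U hUD hUne (fun i hi => ht i (hUD.subset hi)) hU
    exact ⟨D', hD'.trans hUD.subset, h⟩
  push Not at hmin
  obtain ⟨i, hi⟩ := hne
  have : Nonempty A := (ht i hi).to_type
  have hDge : #D ≤ #(D.biUnion t) := by
    obtain hempty | hne' := (D.erase i).eq_empty_or_nonempty
    · have hcard := card_erase_add_one hi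
      have hpos : 0 < #(D.biUnion t) := card_pos.2 (Nonempty.biUnion ⟨i, hi⟩ ht)
      rw [hempty, card_empty] at hcard
      omega
    · have hlt := hmin _ (erase_ssubset hi) hne'
      have hle := card_le_card (biUnion_subset_biUnion_of_subset_left t (erase_subset i D))
      have hcard := card_erase_add_one hi
      omega
  obtain ⟨g, hg, hgt⟩ := exists_injOn_of_card_le_card_biUnion (t := t) (D := D) fun U hU => by
    obtain rfl | hUne := U.eq_empty_or_nonempty
    · simp
    obtain rfl | hUD := hU.eq_or_ssubset
    exacts [hDge, (hmin U hUD hUne).le]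
  refine ⟨D, Subset.rfl, ⟨i, hi⟩, g, hg, hgt, (eq_of_subset_of_card_le ?_ ?_).ge⟩
  · exact image_subset_iff.2 fun j hj => mem_biUnion.2 ⟨j, hj, hgt j hj⟩
  · rwa [card_image_of_injOn hg]

end Hall

section BalancedLabeling

variable [DecidableEq A] [DecidableEq B]

/-- A matching of the bipartite multigraph `F` whose deletion lowers the larger end degree of every
edge that meets it in a `b`-end. -/
structure IsPeelable (a : E → A) (b : E → B) (F M : Finset E) : Prop where
  subset : M ⊆ F
  nonempty : M.Nonempty
  injOn_left : Set.InjOn a M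
  injOn_right : Set.InjOn b M
  mem_image_left : ∀ e ∈ F, b e ∈ b '' M → degreeAt b F e ≤ degreeAt a F e → a e ∈ a '' M

/-- The `a`-neighbors of the `b`-vertex `y` whose degree is at least that of `y`. -/
def dominatingNeighbors (a : E → A) (b : E → B) (F : Finset E) (y : B) : Finset A :=
  {e ∈ F | b e = y ∧ degreeAt b F e ≤ degreeAt a F e}.image a

theorem mem_dominatingNeighbors {x : A} {y : B} : x ∈ dominatingNeighbors a b F y ↔
    ∃ e ∈ F, a e = x ∧ b e = y ∧ degreeAt b F e ≤ degreeAt a F e := by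
  simp only [dominatingNeighbors, mem_image, mem_filter]
  grind

theorem isPeelable_singleton (he : e ∈ F) (h : dominatingNeighbors a b F (b e) = ∅) :
    IsPeelable a b F {e} where
  subset := singleton_subset_iff.2 he
  nonempty := singleton_nonempty e
  injOn_left := by simp
  injOn_right := by simp
  mem_image_left f hf hbf hdeg := by
    have hfe : b f = b e := by simpa using hbf
    exact absurd (mem_dominatingNeighbors.2 ⟨f, hf, rfl, hfe, hdeg⟩) (h ▸ notMem_empty _)

theorem exists_isPeelable_of_injOn {D : Finset B} (hD : D.Nonempty) {g : B → A}
    (hg : Set.InjOn g D) (hgD : ∀ y ∈ D, g y ∈ dominatingNeighbors a b F y)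
    (hcover : D.biUnion (dominatingNeighbors a b F) ⊆ D.image g) :
    ∃ M, IsPeelable a b F M := by
  classical
  have hedge : ∀ y : D, ∃ e ∈ F, a e = g y ∧ b e = y := fun y => by
    obtain ⟨e, he, hae, hbe, -⟩ := mem_dominatingNeighbors.1 (hgD y y.2)
    exact ⟨e, he, hae, hbe⟩
  choose edge hedgeF hedgea hedgeb using hedge
  have hmemM : ∀ {e}, e ∈ univ.image edge ↔ ∃ y, edge y = e := by simp
  refine ⟨univ.image edge, image_subset_iff.2 fun y _ => hedgeF y,
    (univ_nonempty_iff.2 hD.to_subtype).image _, ?_, ?_, ?_⟩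
  · intro e he f hf hef
    obtain ⟨y, rfl⟩ := hmemM.1 he
    obtain ⟨z, rfl⟩ := hmemM.1 hf
    rw [hedgea, hedgea] at hef
    rw [Subtype.ext (hg y.2 z.2 hef)]
  · intro e he f hf hef
    obtain ⟨y, rfl⟩ := hmemM.1 he
    obtain ⟨z, rfl⟩ := hmemM.1 hf
    rw [hedgeb, hedgeb] at hef
    rw [Subtype.ext hef]
  · rintro e he ⟨_, hm, hme⟩ hdeg
    obtain ⟨y, rfl⟩ := hmemM.1 hm
    rw [hedgeb] at hme
    obtain ⟨z, hz, hze⟩ := mem_image.1 <| hcover <| mem_biUnion.2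
      ⟨y, y.2, mem_dominatingNeighbors.2 ⟨e, he, rfl, hme.symm, hdeg⟩⟩
    exact ⟨edge ⟨z, hz⟩, hmemM.2 ⟨_, rfl⟩, (hedgea _).trans hze⟩

theorem exists_isPeelable_of_card_biUnion_le {D : Finset B} (hne : D.Nonempty)
    (hDF : D ⊆ F.image b) (hD : #(D.biUnion (dominatingNeighbors a b F)) ≤ #D) :
    ∃ M, IsPeelable a b F M := by
  by_cases hempty : ∃ y ∈ D, dominatingNeighbors a b F y = ∅
  · obtain ⟨y, hy, hempty⟩ := hempty
    obtain ⟨e, he, rfl⟩ := mem_image.1 (hDF hy)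
    exact ⟨{e}, isPeelable_singleton he hempty⟩
  · push Not at hempty
    obtain ⟨D', -, hne', g, hg, hgD, hcover⟩ := exists_injOn_biUnion_subset_image hne hempty hD
    exact exists_isPeelable_of_injOn hne' hg hgD hcover

/-- The `a`-ends of degree `Δ` in the multigraph `F`. -/
def endsOfDegree (a : E → A) (F : Finset E) (Δ : ℕ) : Finset A :=
  {e ∈ F | degreeAt a F e = Δ}.image a

theorem exists_isPeelable_of_card_endsOfDegree_le {Δ : ℕ} (ha : ∀ e ∈ F, degreeAt a F e ≤ Δ)
    (hne : (endsOfDegree b F Δ).Nonempty) (hcard : #(endsOfDegree a F Δ) ≤ #(endsOfDegree b F Δ)) :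
    ∃ M, IsPeelable a b F M := by
  refine exists_isPeelable_of_card_biUnion_le hne (image_subset_image (filter_subset _ _))
    ((card_le_card fun x hx => ?_).trans hcard)
  obtain ⟨y, hy, hxy⟩ := mem_biUnion.1 hx
  obtain ⟨f, hf, rfl⟩ := mem_image.1 hy
  obtain ⟨e, he, rfl, hef, hdeg⟩ := mem_dominatingNeighbors.1 hxy
  have hΔ : Δ ≤ degreeAt a F e := by rwa [degreeAt_congr hef, (mem_filter.1 hf).2] at hdeg
  exact mem_image.2 ⟨e, mem_filter.2 ⟨he, (ha e he).antisymm hΔ⟩, rfl⟩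

theorem exists_isPeelable (hF : F.Nonempty) :
    (∃ M, IsPeelable a b F M) ∨ ∃ M, IsPeelable b a F M := by
  obtain ⟨e, he, hmax⟩ := exists_max_image F (fun e => max (degreeAt a F e) (degreeAt b F e)) hF
  set Δ := max (degreeAt a F e) (degreeAt b F e) with hΔ
  have ha : ∀ f ∈ F, degreeAt a F f ≤ Δ := fun f hf => (le_max_left _ _).trans (hmax f hf)
  have hb : ∀ f ∈ F, degreeAt b F f ≤ Δ := fun f hf => (le_max_right _ _).trans (hmax f hf)
  have hpos : 0 < #(endsOfDegree a F Δ) ∨ 0 < #(endsOfDegree b F Δ) := by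
    obtain h | h := max_choice (degreeAt a F e) (degreeAt b F e)
    · exact .inl (card_pos.2 ⟨a e, mem_image_of_mem a (mem_filter.2 ⟨he, (hΔ.trans h).symm⟩)⟩)
    · exact .inr (card_pos.2 ⟨b e, mem_image_of_mem b (mem_filter.2 ⟨he, (hΔ.trans h).symm⟩)⟩)
  obtain h | h := le_total #(endsOfDegree a F Δ) #(endsOfDegree b F Δ)
  · exact .inl (exists_isPeelable_of_card_endsOfDegree_le ha (card_pos.1 (by omega)) h)
  · exact .inr (exists_isPeelable_of_card_endsOfDegree_le hb (card_pos.1 (by omega)) h)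

/-- A labeling of the edges of the bipartite multigraph `F` that is proper at both ends and such
that, when the `a`-ends prefer small and the `b`-ends prefer large labels, fewer edges are preferred
to an edge than the larger of its end degrees. -/
structure IsBalanced (a : E → A) (b : E → B) (F : Finset E) (c : E → ℤ) : Prop where
  proper_left : IsProperAt a F c
  proper_right : IsProperAt b F c
  rankAt_add_rankAt_neg_lt : ∀ e ∈ F,
    rankAt a c F e + rankAt b (-c) F e < max (degreeAt a F e) (degreeAt b F e)

theorem IsBalanced.neg {c : E → ℤ} (h : IsBalanced a b F c) : IsBalanced b a F (-c) where
  proper_left := h.proper_right.neg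
  proper_right := h.proper_left.neg
  rankAt_add_rankAt_neg_lt e he := by
    rw [neg_neg, add_comm, max_comm]
    exact h.rankAt_add_rankAt_neg_lt e he

section PiecewiseRank

variable [DecidableEq E] {c : E → ℤ} {z : ℤ}

theorem rankAt_piecewise_le (hz : c e < z) (he : e ∉ M) :
    rankAt a (M.piecewise (fun _ => z) c) F e ≤ rankAt a c (F \ M) e := by
  refine card_le_card fun f hf => ?_
  obtain ⟨hfF, hfe, hlt⟩ := mem_filter.1 hf
  rw [piecewise_eq_of_notMem _ _ _ he] at hlt
  have hfM : f ∉ M := fun hfM => by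
    rw [piecewise_eq_of_mem _ _ _ hfM] at hlt
    exact lt_asymm hlt hz
  rw [piecewise_eq_of_notMem _ _ _ hfM] at hlt
  exact mem_filter.2 ⟨mem_sdiff.2 ⟨hfF, hfM⟩, hfe, hlt⟩

theorem rankAt_neg_piecewise_eq_zero (hz : ∀ f ∈ F, c f < z) (he : e ∈ M) :
    rankAt b (-M.piecewise (fun _ => z) c) F e = 0 := by
  refine card_eq_zero.2 (filter_eq_empty_iff.2 fun f hf h => ?_)
  have hlt := neg_lt_neg_iff.1 h.2
  rw [piecewise_eq_of_mem _ _ _ he] at hlt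
  have hle : M.piecewise (fun _ => z) c f ≤ z := by
    by_cases hfM : f ∈ M
    · rw [piecewise_eq_of_mem _ _ _ hfM]
    · rw [piecewise_eq_of_notMem _ _ _ hfM]
      exact (hz f hf).le
  exact hlt.not_ge hle

theorem rankAt_neg_piecewise_le (he : e ∉ M) :
    rankAt b (-M.piecewise (fun _ => z) c) F e ≤
      rankAt b (-c) (F \ M) e + degreeAt b M e := by
  refine (card_le_card fun f hf => ?_).trans (card_union_le _ _)
  obtain ⟨hfF, hfe, hlt⟩ := mem_filter.1 hf
  by_cases hfM : f ∈ M
  · exact mem_union_right _ (mem_filter.2 ⟨hfM, hfe⟩)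
  · rw [Pi.neg_apply, Pi.neg_apply, piecewise_eq_of_notMem _ _ _ he,
      piecewise_eq_of_notMem _ _ _ hfM] at hlt
    exact mem_union_left _ (mem_filter.2 ⟨mem_sdiff.2 ⟨hfF, hfM⟩, hfe, hlt⟩)

end PiecewiseRank

theorem degreeAt_le_one (hM : Set.InjOn b M) : degreeAt b M e ≤ 1 :=
  card_le_one.2 fun _ hf _ hg => hM (mem_filter.1 hf).1 (mem_filter.1 hg).1
    ((mem_filter.1 hf).2.trans (mem_filter.1 hg).2.symm)

theorem IsPeelable.max_degreeAt_sdiff_add_le [DecidableEq E] (hM : IsPeelable a b F M)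
    (he : e ∈ F) :
    max (degreeAt a (F \ M) e) (degreeAt b (F \ M) e) + degreeAt b M e ≤
      max (degreeAt a F e) (degreeAt b F e) := by
  have hb := degreeAt_sdiff_add (a := b) (e := e) hM.subset
  have ha : degreeAt a (F \ M) e ≤ degreeAt a F e := degreeAt_mono sdiff_subset
  have hone : degreeAt b M e ≤ 1 := degreeAt_le_one hM.injOn_right
  obtain hzero | hpos := (degreeAt b M e).eq_zero_or_pos
  · omega
  obtain ⟨m, hm⟩ := card_pos.1 hpos
  obtain ⟨hmM, hme⟩ := mem_filter.1 hm
  by_cases hdeg : degreeAt b F e ≤ degreeAt a F e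
  · have hlt := degreeAt_sdiff_lt hM.subset (hM.mem_image_left e he ⟨m, hmM, hme⟩ hdeg)
    omega
  · omega

/-- The edges of the matching become the least preferred ones at their `a`-ends and the most
preferred ones at their `b`-ends. -/
theorem IsPeelable.isBalanced_piecewise [DecidableEq E] {c : E → ℤ} {z : ℤ}
    (hM : IsPeelable a b F M) (hc : IsBalanced a b (F \ M) c) (hz : ∀ e ∈ F, c e < z) :
    IsBalanced a b F (M.piecewise (fun _ => z) c) where
  proper_left := hc.proper_left.piecewise_const hM.injOn_left
    fun e he => (hz e (sdiff_subset he)).ne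
  proper_right := hc.proper_right.piecewise_const hM.injOn_right
    fun e he => (hz e (sdiff_subset he)).ne
  rankAt_add_rankAt_neg_lt e he := by
    by_cases heM : e ∈ M
    · rw [rankAt_neg_piecewise_eq_zero hz heM, add_zero]
      exact lt_max_of_lt_left (rankAt_lt_degreeAt he)
    · have hleft := rankAt_piecewise_le (a := a) (F := F) (hz e he) heM
      have hright := rankAt_neg_piecewise_le (b := b) (F := F) (c := c) (z := z) heM
      have hold := hc.rankAt_add_rankAt_neg_lt e (mem_sdiff.2 ⟨he, heM⟩)
      have hdrop := hM.max_degreeAt_sdiff_add_le he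
      omega

theorem IsPeelable.exists_isBalanced [DecidableEq E] {c : E → ℤ} (hM : IsPeelable a b F M)
    (hc : IsBalanced a b (F \ M) c) : ∃ c', IsBalanced a b F c' := by
  obtain ⟨z, hz⟩ := (F.image c).bddAbove
  exact ⟨_, hM.isBalanced_piecewise hc fun e he =>
    Int.lt_add_one_of_le (hz (mem_coe.2 (mem_image_of_mem c he)))⟩

theorem exists_isBalanced (a : E → A) (b : E → B) (F : Finset E) : ∃ c, IsBalanced a b F c := by
  classical
  induction F using Finset.strongInduction with
  | H F ih =>
  obtain rfl | hF := F.eq_empty_or_nonempty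
  · exact ⟨0, by simp [IsProperAt], by simp [IsProperAt], by simp⟩
  obtain ⟨M, hM⟩ | ⟨M, hM⟩ := exists_isPeelable (a := a) (b := b) hF
  · obtain ⟨c, hc⟩ := ih (F \ M) (sdiff_ssubset hM.subset hM.nonempty)
    exact hM.exists_isBalanced hc
  · obtain ⟨c, hc⟩ := ih (F \ M) (sdiff_ssubset hM.subset hM.nonempty)
    obtain ⟨c', hc'⟩ := hM.exists_isBalanced hc.neg
    exact ⟨-c', hc'.neg⟩

/-- The Borodin–Kostochka–Woodall theorem. -/
theorem exists_listColoring_of_max_degreeAt_le [Nonempty C] (L : E → Finset C)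
    (hL : ∀ e ∈ F, max (degreeAt a F e) (degreeAt b F e) ≤ #(L e)) :
    ∃ c : E → C, (∀ e ∈ F, c e ∈ L e) ∧ IsProperAt a F c ∧ IsProperAt b F c := by
  obtain ⟨c, hc⟩ := exists_isBalanced a b F
  exact exists_listColoring_of_rankAt_lt L hc.proper_left hc.proper_right.neg
    fun e he => (hc.rankAt_add_rankAt_neg_lt e he).trans_le (hL e he)

end BalancedLabeling

section Extension

/-- The edge coloring `h` of the multigraph `F` and the coloring `v` of the `a`-ends satisfy the
conditions of a total coloring that concern edges and their `a`-ends. -/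
structure IsTotalAt (a : E → A) (F : Finset E) (v : A → C) (h : E → C) : Prop where
  proper : IsProperAt a F h
  ne_end : ∀ e ∈ F, h e ≠ v (a e)

variable [DecidableEq A]

section Forbidden

variable [DecidableEq C]

/-- The colors that the `a`-end of an edge `e` outside `P` forbids for `e`, when `v` colors the
`a`-ends and `g` colors the edges in `P`. -/
def forbiddenAt (a : E → A) (P : Finset E) (v : A → C) (g : E → C) (e : E) : Finset C :=
  insert (v (a e)) ({f ∈ P | a f = a e}.image g)

theorem card_forbiddenAt_le {v : A → C} {g : E → C} :
    #(forbiddenAt a P v g e) ≤ degreeAt a P e + 1 :=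
  (card_insert_le _ _).trans (Nat.add_le_add_right card_image_le 1)

theorem IsTotalAt.piecewise [DecidableEq E] {v : A → C} {g c : E → C} (hg : IsTotalAt a P v g)
    (hc : IsProperAt a (F \ P) c) (hforb : ∀ e ∈ F \ P, c e ∉ forbiddenAt a P v g e) :
    IsTotalAt a F v (P.piecewise g c) where
  proper := hg.proper.piecewise hc fun e he f hf hef hgc => hforb f hf <|
    mem_insert_of_mem <| hgc ▸ mem_image_of_mem g (mem_filter.2 ⟨he, hef⟩)
  ne_end e he := by
    by_cases heP : e ∈ P
    · rw [piecewise_eq_of_mem _ _ _ heP]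
      exact hg.ne_end e heP
    · rw [piecewise_eq_of_notMem _ _ _ heP]
      exact fun h => hforb e (mem_sdiff.2 ⟨he, heP⟩) (h ▸ mem_insert_self _ _)

end Forbidden

theorem exists_isTotalAt_extending [DecidableEq B] [Fintype C] {Δ d : ℕ} (hPF : P ⊆ F)
    (haF : ∀ e ∈ F, degreeAt a F e ≤ Δ) (hbF : ∀ e ∈ F, degreeAt b F e ≤ Δ)
    (haP : ∀ e ∈ F, degreeAt a P e ≤ d) (hbP : ∀ e ∈ F, degreeAt b P e ≤ d)
    (hC : Δ + d + 2 ≤ Fintype.card C) {v : A → C} {w : B → C} {g : E → C}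
    (hga : IsTotalAt a P v g) (hgb : IsTotalAt b P w g) :
    ∃ h : E → C, (∀ e ∈ P, h e = g e) ∧ IsTotalAt a F v h ∧ IsTotalAt b F w h := by
  classical
  have : Nonempty C := Fintype.card_pos_iff.1 (by omega)
  let L (e : E) : Finset C := univ \ (forbiddenAt a P v g e ∪ forbiddenAt b P w g e)
  have hL : ∀ e ∈ F \ P, max (degreeAt a (F \ P) e) (degreeAt b (F \ P) e) ≤ #(L e) := by
    intro e he
    obtain ⟨heF, -⟩ := mem_sdiff.1 he
    have hcard : #(L e) + #(forbiddenAt a P v g e ∪ forbiddenAt b P w g e) = Fintype.card C :=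
      card_sdiff_add_card_eq_card (subset_univ _)
    have hunion := card_union_le (forbiddenAt a P v g e) (forbiddenAt b P w g e)
    have hforba := card_forbiddenAt_le (a := a) (P := P) (e := e) (v := v) (g := g)
    have hforbb := card_forbiddenAt_le (a := b) (P := P) (e := e) (v := w) (g := g)
    have hsuma := degreeAt_sdiff_add (a := a) (e := e) hPF
    have hsumb := degreeAt_sdiff_add (a := b) (e := e) hPF
    have := haF e heF
    have := hbF e heF
    have := haP e heF
    have := hbP e heF
    omega
  obtain ⟨c, hcL, hca, hcb⟩ := exists_listColoring_of_max_degreeAt_le L hL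
  have hforb : ∀ e ∈ F \ P, c e ∉ forbiddenAt a P v g e ∪ forbiddenAt b P w g e :=
    fun e he => (mem_sdiff.1 (hcL e he)).2
  exact ⟨P.piecewise g c, fun e he => piecewise_eq_of_mem _ _ _ he,
    hga.piecewise hca fun e he h => hforb e he (mem_union_left _ h),
    hgb.piecewise hcb fun e he h => hforb e he (mem_union_right _ h)⟩

end Extension

end BipartiteMultigraph

section SimpleGraph

variable {V : Type*} {G : SimpleGraph V}

theorem exists_coloring_insert {α : Type*} [Fintype α] {s : Set V} (c : (G.induce s).Coloring α)
    {x : V} [Fintype (G.neighborSet x)] (hx : G.degree x < Fintype.card α) :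
    ∃ c' : (G.induce (insert x s)).Coloring α,
      ∀ v (hv : v ∈ s), c' ⟨v, Set.mem_insert_of_mem x hv⟩ = c ⟨v, hv⟩ := by
  classical
  obtain ⟨z, hz⟩ : ∃ z, ∀ v (hv : v ∈ s), G.Adj x v → c ⟨v, hv⟩ ≠ z := by
    by_contra! h
    choose v hv hadj hvz using h
    have hinj : Function.Injective fun z => (⟨v z, hadj z⟩ : G.neighborSet x) := fun z w hzw => by
      have hvzw : v z = v w := Subtype.ext_iff.1 hzw
      rw [← hvz z, ← hvz w]
      simp only [hvzw]
    have hle := Fintype.card_le_of_injective _ hinj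
    rw [G.card_neighborSet_eq_degree] at hle
    exact hx.not_ge hle
  refine ⟨.mk (fun v => if hv : v.1 ∈ s then c ⟨v, hv⟩ else z) fun {u v} huv => ?_,
    fun v hv => dif_pos hv⟩
  have hG : G.Adj u v := huv
  by_cases hu : u.1 ∈ s <;> by_cases hv : v.1 ∈ s
  · rw [dif_pos hu, dif_pos hv]
    exact c.valid hG
  · rw [dif_pos hu, dif_neg hv]
    exact hz u hu (by simpa only [v.2.resolve_right hv] using hG.symm)
  · rw [dif_neg hu, dif_pos hv]
    exact (hz v hv (by simpa only [u.2.resolve_right hu] using hG)).symm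
  · exact absurd ((u.2.resolve_right hu).trans (v.2.resolve_right hv).symm) hG.ne

theorem exists_coloring_extending [Fintype V] [DecidableRel G.Adj] {α : Type*} [Fintype α]
    (hα : G.maxDegree < Fintype.card α) {s : Set V} (c : (G.induce s).Coloring α) :
    ∃ c' : G.Coloring α, ∀ v : s, c' v = c v := by
  induction s using WellFoundedGT.induction with
  | ind s ih =>
  by_cases hs : ∃ x, x ∉ s
  · obtain ⟨x, hx⟩ := hs
    obtain ⟨c₁, hc₁⟩ := exists_coloring_insert c ((G.degree_le_maxDegree x).trans_lt hα)
    obtain ⟨c₂, hc₂⟩ := ih _ (Set.ssubset_insert hx) c₁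
    exact ⟨c₂, fun v => (hc₂ ⟨v, _⟩).trans (hc₁ v v.2)⟩
  · push Not at hs
    exact ⟨.mk (fun v => c ⟨v, hs v⟩) fun h => c.valid h, fun _ => rfl⟩

/-- The maps `a` and `b` send every edge of `G` to its end in the first and in the second part of
some bipartition of `G`; they turn `G` into a bipartite multigraph. -/
structure IsBipartiteEnds (a b : G.edgeSet → V) : Prop where
  eq_mk : ∀ e, e.1 = s(a e, b e)
  ne : ∀ e f, a e ≠ b f

theorem exists_isBipartiteEnds (hG : G.IsBipartite) :
    ∃ a b : G.edgeSet → V, IsBipartiteEnds a b := by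
  obtain ⟨s, t, hst⟩ := hG.exists_isBipartiteWith
  have hends : ∀ e : G.edgeSet, ∃ x ∈ s, ∃ y ∈ t, e.1 = s(x, y) := by
    rintro ⟨e, he⟩
    induction e with
    | h u v =>
      obtain ⟨hu, hv⟩ | ⟨hu, hv⟩ := hst.mem_of_adj he
      exacts [⟨u, hu, v, hv, rfl⟩, ⟨v, hv, u, hu, Sym2.eq_swap⟩]
  choose a ha b hb hab using hends
  exact ⟨a, b, hab, fun e f => hst.disjoint.ne_of_mem (ha e) (hb f)⟩

namespace IsBipartiteEnds

variable {a b : G.edgeSet → V} {e f : G.edgeSet} {v : V}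

theorem mem_iff (hab : IsBipartiteEnds a b) : v ∈ e.1 ↔ v = a e ∨ v = b e := by
  rw [hab.eq_mk, Sym2.mem_iff]

theorem eq_or_eq_of_mem_of_mem (hab : IsBipartiteEnds a b) (he : v ∈ e.1) (hf : v ∈ f.1) :
    a e = a f ∨ b e = b f := by
  obtain rfl | rfl := hab.mem_iff.1 he <;> obtain h | h := hab.mem_iff.1 hf
  exacts [.inl h, (hab.ne _ _ h).elim, (hab.ne _ _ h.symm).elim, .inr h]

end IsBipartiteEnds

theorem degreeAt_le_degree [DecidableEq V] {a : G.edgeSet → V} (ha : ∀ e, a e ∈ e.1)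
    {K : SimpleGraph V} {P : Finset G.edgeSet} (hP : ∀ e ∈ P, e.1 ∈ K.edgeSet) (e : G.edgeSet)
    [Fintype (K.neighborSet (a e))] : degreeAt a P e ≤ K.degree (a e) := by
  rw [← K.card_incidenceFinset_eq_degree]
  refine card_le_card_of_injOn Subtype.val (fun f hf => ?_) Subtype.val_injective.injOn
  obtain ⟨hfP, hfe⟩ := mem_filter.1 hf
  exact (K.mem_incidenceFinset _ _).2 ⟨hP f hfP, hfe ▸ ha f⟩

/-- The total coloring of `G` made of a vertex and an edge coloring that fit together at both ends
of every edge. -/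
def TotalColoring.ofEnds [Fintype G.edgeSet] {a b : G.edgeSet → V} {k : ℕ}
    (hab : IsBipartiteEnds a b) (c : G.Coloring (Fin k)) (h : G.edgeSet → Fin k)
    (ha : IsTotalAt a univ c h) (hb : IsTotalAt b univ c h) : TotalColoring G k where
  vert := c
  edge := .mk h fun {e f} hef heq => by
    obtain ⟨hne, v, hve, hvf⟩ := G.lineGraph_adj_iff_exists.1 hef
    obtain hends | hends := hab.eq_or_eq_of_mem_of_mem hve hvf
    · exact hne (ha.proper (mem_univ e) (mem_univ f) hends heq)
    · exact hne (hb.proper (mem_univ e) (mem_univ f) hends heq)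
  edge_ne_vert e v hv := by
    obtain rfl | rfl := hab.mem_iff.1 hv
    exacts [ha.ne_end e (mem_univ e), hb.ne_end e (mem_univ e)]

section Subgraph

variable {H : G.Subgraph} {a : G.edgeSet → V} {P : Finset G.edgeSet}

theorem mem_range_mapEdgeSet_hom {e : G.edgeSet} :
    e ∈ Set.range H.hom.mapEdgeSet ↔ e.1 ∈ H.edgeSet := by
  constructor
  · rintro ⟨⟨e, he⟩, rfl⟩
    induction e with
    | h u v => exact he
  · obtain ⟨e, he⟩ := e
    induction e with
    | h u v =>
      exact fun huv : H.Adj u v => ⟨⟨s(⟨u, huv.fst_mem⟩, ⟨v, huv.snd_mem⟩), huv⟩, rfl⟩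

theorem degreeAt_le_of_subgraph_degree_le [DecidableEq V] [∀ v, Fintype (H.neighborSet v)] {d : ℕ}
    (hd : ∀ v ∈ H.verts, H.degree v ≤ d) (ha : ∀ e, a e ∈ e.1)
    (hP : ∀ e ∈ P, e.1 ∈ H.edgeSet) (e : G.edgeSet) : degreeAt a P e ≤ d := by
  classical
  let _ : Fintype (H.spanningCoe.neighborSet (a e)) :=
    inferInstanceAs (Fintype (H.neighborSet (a e)))
  refine (degreeAt_le_degree (K := H.spanningCoe) ha hP e).trans ?_
  rw [SimpleGraph.Subgraph.degree_spanningCoe]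
  by_cases hv : a e ∈ H.verts
  · exact hd _ hv
  · rw [SimpleGraph.Subgraph.degree_of_notMem_verts hv]
    exact Nat.zero_le d

theorem TotalColoring.isTotalAt {k : ℕ} (φ : TotalColoring H.coe k) {c : V → Fin k}
    {g : G.edgeSet → Fin k} (ha : ∀ e, a e ∈ e.1) (hP : ∀ e ∈ P, e.1 ∈ H.edgeSet)
    (hc : ∀ v : H.verts, c v = φ.vert v) (hg : ∀ e, g (H.hom.mapEdgeSet e) = φ.edge e) :
    IsTotalAt a P c g where
  proper e he f hf hef hgef := by
    obtain ⟨e, rfl⟩ := mem_range_mapEdgeSet_hom.2 (hP e he)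
    obtain ⟨f, rfl⟩ := mem_range_mapEdgeSet_hom.2 (hP f hf)
    obtain ⟨u, hue, hu⟩ := Sym2.mem_map.1 (ha (H.hom.mapEdgeSet e))
    obtain ⟨v, hvf, hv⟩ := Sym2.mem_map.1 (ha (H.hom.mapEdgeSet f))
    obtain rfl : u = v := Subtype.ext (hu.trans (hef.trans hv.symm))
    rw [hg, hg] at hgef
    by_contra hne
    exact φ.edge.valid
      (H.coe.lineGraph_adj_iff_exists.2 ⟨fun h => hne (congrArg _ h), u, hue, hvf⟩) hgef
  ne_end e he := by
    obtain ⟨e, rfl⟩ := mem_range_mapEdgeSet_hom.2 (hP e he)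
    obtain ⟨u, hue, hu⟩ := Sym2.mem_map.1 (ha (H.hom.mapEdgeSet e))
    have hau : a (H.hom.mapEdgeSet e) = u := hu.symm
    rw [hg, hau, hc]
    exact φ.edge_ne_vert e u hue

end Subgraph

end SimpleGraph

end TotalColoringExtension

open TotalColoringExtension in
theorem mainTheorem4_general {V : Type*} [Fintype V] (G : SimpleGraph V) [DecidableRel G.Adj]
    (hbip : G.IsBipartite) (H : G.Subgraph) [∀ v : V, Fintype (H.neighborSet v)] {d k : ℕ}
    (hd : ∀ v ∈ H.verts, H.degree v ≤ d) (hk : G.maxDegree + d + 2 ≤ k)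
    (φ : TotalColoring H.coe k) (hφ : φ.IsIn) : ∃ ψ : TotalColoring G k, ψ.Extends φ := by
  classical
  obtain ⟨a, b, hab⟩ := exists_isBipartiteEnds hbip
  have ha (e) : a e ∈ e.1 := hab.mem_iff.2 (.inl rfl)
  have hb (e) : b e ∈ e.1 := hab.mem_iff.2 (.inr rfl)
  obtain ⟨c, hc : ∀ v : H.verts, c v = φ.vert v⟩ := exists_coloring_extending
    (by rw [Fintype.card_fin]; omega) (.mk φ.vert (hφ _ _) : (G.induce H.verts).Coloring (Fin k))
  let P : Finset G.edgeSet := {e | e.1 ∈ H.edgeSet}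
  let g : G.edgeSet → Fin k := Function.extend H.hom.mapEdgeSet φ.edge (c ∘ a)
  have hP : ∀ e ∈ P, e.1 ∈ H.edgeSet := fun e he => (Finset.mem_filter.1 he).2
  have hg : ∀ e, g (H.hom.mapEdgeSet e) = φ.edge e :=
    (SimpleGraph.Hom.mapEdgeSet.injective _ H.hom_injective).extend_apply φ.edge _
  have hdegree {a : G.edgeSet → V} (ha : ∀ e, a e ∈ e.1) (e : G.edgeSet) :
      degreeAt a Finset.univ e ≤ G.maxDegree :=
    (degreeAt_le_degree ha (fun f _ => f.2) e).trans (G.degree_le_maxDegree _)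
  obtain ⟨h, hhg, hha, hhb⟩ := exists_isTotalAt_extending (Finset.subset_univ P)
    (fun e _ => hdegree ha e) (fun e _ => hdegree hb e)
    (fun e _ => degreeAt_le_of_subgraph_degree_le hd ha hP e)
    (fun e _ => degreeAt_le_of_subgraph_degree_le hd hb hP e)
    (by rwa [Fintype.card_fin]) (φ.isTotalAt ha hP hc hg) (φ.isTotalAt hb hP hc hg)
  have hmemP (e) : H.hom.mapEdgeSet e ∈ P :=
    Finset.mem_filter.2 ⟨Finset.mem_univ _, mem_range_mapEdgeSet_hom.1 ⟨e, rfl⟩⟩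
  exact ⟨.ofEnds hab c h hha hhb, hc, fun e => (hhg _ (hmemP e)).trans (hg e)⟩

theorem mainTheorem4 {V : Type*} [Fintype V] (G : SimpleGraph V) [DecidableRel G.Adj]
    (hplanar : TotalColoringExtension.IsPlanar G) (hbip : G.IsBipartite)
    (H : G.Subgraph) [∀ v : V, Fintype (H.neighborSet v)] (d : ℕ)
    (hd : ∀ v ∈ H.verts, H.degree v ≤ d)
    (φ : TotalColoringExtension.TotalColoring H.coe (G.maxDegree + d + 4)) (hφ : φ.IsIn) :
    ∃ ψ : TotalColoringExtension.TotalColoring G (G.maxDegree + d + 4), ψ.Extends φ := by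
  exact mainTheorem4_general G hbip H hd (by omega) φ hφ
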